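/- \textbf{Theorem (multilinear 2-categorical universal property of Freyd categories).} All functors are covariant. An additive category is a preadditive category with finite direct sums (in particular a zero object). For an additive category $\mathbf{A}$, its Freyd category $\mathcal{A}(\mathbf{A})$ has as objects the morphisms $A=(a\xleftarrow{\rho_a} r_a)$ of $\mathbf{A}$. A morphism from $A=(a\xleftarrow{\rho_a} r_a)$ to $B=(b\xleftarrow{\rho_b} r_b)$ is represented by a morphism $\alpha:a\to b$ for which there is some $\omega:r_a\to r_b$ with $\alpha\circ\rho_a=\rho_b\circ\omega$ (write $\{\alpha,\omega\}$); $\alpha$ and $\alpha'$ represent the same morphism if and only if $\alpha-\alpha'=\rho_b\circ\lambda$ for some $\lambda:a\to r_b$. Composition, identities and addition are inherited from $\mathbf{A}$. The category $\mathcal{A}(\mathbf{A})$ is additive and has cokernels, and there is an embedding $\mathrm{emb}:\mathbf{A}\to\mathcal{A}(\mathbf{A})$, $a\mapsto(a\leftarrow 0)$. Let $n\in\mathbb{N}$. An $n$-ary functor $F:\mathbf{C}_1\times\dots\times\mathbf{C}_n\to\mathbf{B}$ between additive categories is \emph{multilinear} if it is additive in each component. If the categories $\mathbf{C}_i$ and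 $\mathbf{B}$ have cokernels, a multilinear functor $F$ is \emph{right exact} if for every $k$, all objects $c_i\in\mathbf{C}_i$ ($i\ne k$) and every morphism $\alpha_k$ of $\mathbf{C}_k$ the natural morphism $$\mathrm{cok}\,F(c_1,\dots,\alpha_k,\dots,c_n)\longrightarrow F(c_1,\dots,\mathrm{cok}(\alpha_k),\dots,c_n)$$ is an isomorphism. Let $\mathrm{Hom}_{\mathrm{lin}}((\mathbf{C}_i)_i,\mathbf{B})$ be the category of multilinear functors $\prod_i\mathbf{C}_i\to\mathbf{B}$ and natural transformations, and let $\mathrm{Hom}_{\mathrm{lin}}^{\mathrm{cok}}((\mathbf{C}_i)_i,\mathbf{B})$ be its full subcategory of right exact multilinear functors. Let $\mathbf{A}_1,\dots,\mathbf{A}_n$ be additive categories and let $\mathbf{B}$ be an additive category with cokernels. For a multilinear functor $F:\prod_i\mathbf{A}_i\to\mathbf{B}$ let $\widehat F:\prod_i\mathcal{A}(\mathbf{A}_i)\to\mathbf{B}$ be the functor given on objects $A_i=(a_i\xleftarrow{\rho_{a_i}} r_{a_i})$ by $$\widehat F(A_1,\dots,A_n)=\mathrm{cok}\Big(\bigoplus_{j=1}^n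 F(a_1,\dots,r_{a_j},\dots,a_n)\xrightarrow{\;(F(\mathrm{id},\dots,\rho_{a_j},\dots,\mathrm{id}))_j\;}F(a_1,\dots,a_n)\Big),$$ and on a tuple of morphisms $\{\alpha_i,\omega_i\}$ as the morphism of cokernels induced by $F(\alpha_1,\dots,\alpha_n)$ and $\bigoplus_j F(\alpha_1,\dots,\omega_j,\dots,\alpha_n)$. For a natural transformation $\nu:F\to G$ let $\widehat\nu:\widehat F\to\widehat G$ be the natural transformation induced on cokernels by the components of $\nu$. Then $\widehat F$ is multilinear and right exact for every multilinear functor $F:\prod_i\mathbf{A}_i\to\mathbf{B}$, and there is an equivalence of categories $$\mathrm{Hom}_{\mathrm{lin}}\big((\mathbf{A}_i)_{i},\mathbf{B}\big)\;\simeq\;\mathrm{Hom}_{\mathrm{lin}}^{\mathrm{cok}}\big((\mathcal{A}(\mathbf{A}_i))_{i},\mathbf{B}\big)$$ which is given by $F\mapsto\widehat F$, $\nu\mapsto\widehat\nu$ in one direction, and by the restriction $G\mapsto G\circ(\mathrm{emb}\times\dots\times\mathrm{emb})$ in the other. -/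

import Mathlib

open CategoryTheory CategoryTheory.Limits CategoryTheory.Preadditive

/-!
# Multilinear functors, right exactness, Freyd categories and the cokernel extension

An additive category is a preadditive category with finite biproducts (in particular with a zero
object).  The product of a finite family `A : Fin n → Type _` of categories is Mathlib's category
structure on `∀ i, A i`.  The Freyd category of an additive category `V` is Mathlib's
`CategoryTheory.Preadditive.RightFreyd V`: its objects are the arrows `ρ : r ⟶ a` of `V`, a morphism
from `ρ : r ⟶ a` to `ρ' : r' ⟶ a'` is represented by a commutative square `(ω, α)`,
with `ω : r ⟶ r'` and `α : a ⟶ a'`, and two squares represent the same morphism when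
`α₁ - α₂ = l ≫ ρ'` for some `l : a ⟶ r'`
(so that the choice of `ω` is irrelevant).  The embedding `a ↦ (0 ⟶ a)` is `RightFreyd.functor V`.
-/

universe v u v' u'

namespace FreydMult

noncomputable section

section Update

variable {n : ℕ} {A : Fin n → Type u} [∀ i, Category.{v} (A i)]

/-- Given a tuple of morphisms `f i : a i ⟶ b i` and a morphism `g : x ⟶ y` of `A j`, the tuple of
morphisms with `j`-th component `g` and `i`-th component `f i` for `i ≠ j`, from the tuple
`a` with `j`-th entry replaced by `x` to the tuple `b` with `j`-th entry replaced by `y`. -/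
def updateHom {a b : ∀ i, A i} (f : ∀ i, a i ⟶ b i) (j : Fin n) {x y : A j} (g : x ⟶ y) :
    (Function.update a j x : ∀ i, A i) ⟶ (Function.update b j y : ∀ i, A i) := fun i =>
  if h : i = j then by
    subst h
    exact eqToHom (Function.update_self i x a) ≫ g ≫ eqToHom (Function.update_self i y b).symm
  else
    eqToHom (Function.update_of_ne h x a) ≫ f i ≫ eqToHom (Function.update_of_ne h y b).symm

theorem updateHom_apply_self {a b : ∀ i, A i} (f : ∀ i, a i ⟶ b i) (j : Fin n) {x y : A j}
    (g : x ⟶ y) :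
    updateHom f j g j =
      eqToHom (Function.update_self j x a) ≫ g ≫ eqToHom (Function.update_self j y b).symm := by
  simp [updateHom]

theorem updateHom_apply_of_ne {a b : ∀ i, A i} (f : ∀ i, a i ⟶ b i) (j : Fin n) {x y : A j}
    (g : x ⟶ y) {i : Fin n} (h : i ≠ j) :
    updateHom f j g i =
      eqToHom (Function.update_of_ne h x a) ≫ f i ≫
        eqToHom (Function.update_of_ne h y b).symm := by
  simp [updateHom, h]

theorem updateHom_id (a : ∀ i, A i) (j : Fin n) (x : A j) :
    updateHom (fun i => 𝟙 (a i)) j (𝟙 x) = 𝟙 (Function.update a j x : ∀ i, A i) := by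
  funext i
  by_cases h : i = j
  · subst h; simp [updateHom_apply_self]
  · simp [updateHom_apply_of_ne _ _ _ h]

theorem updateHom_comp {a b c : ∀ i, A i} (f : ∀ i, a i ⟶ b i) (f' : ∀ i, b i ⟶ c i) (j : Fin n)
    {x y z : A j} (g : x ⟶ y) (g' : y ⟶ z) :
    updateHom f j g ≫ updateHom f' j g' = updateHom (fun i => f i ≫ f' i) j (g ≫ g') := by
  funext i
  by_cases h : i = j
  · subst h; simp [updateHom_apply_self]
  · simp [updateHom_apply_of_ne _ _ _ h]

/-- The canonical identification of `a` with `a` whose `j`-th entry is replaced by `a j`. -/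
abbrev updateSelfHom (a : ∀ i, A i) (j : Fin n) :
    (Function.update a j (a j) : ∀ i, A i) ⟶ a :=
  eqToHom (Function.update_eq_self j a)

theorem updateHom_updateSelfHom {a b : ∀ i, A i} (f : a ⟶ b) (j : Fin n) :
    updateHom f j (f j) ≫ updateSelfHom b j = updateSelfHom a j ≫ f := by
  funext i
  by_cases h : i = j
  · subst h; simp [updateHom_apply_self]
  · simp [updateHom_apply_of_ne _ _ _ h]

/-- The functor `A j ⥤ ∏ A i` which fixes all the components of a tuple except the `j`-th one:
`x ↦ (a_1, …, a_{j-1}, x, a_{j+1}, …, a_n)`. -/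
@[simps]
def slot (a : ∀ i, A i) (j : Fin n) : A j ⥤ (∀ i, A i) where
  obj x := Function.update a j x
  map g := updateHom (fun i => 𝟙 (a i)) j g
  map_id x := updateHom_id a j x
  map_comp g g' := by rw [updateHom_comp]; simp

/-- For `g : x ⟶ a j`, the morphism `(id, …, id, g, id, …, id)` from the tuple
`(a_1, …, a_{j-1}, x, a_{j+1}, …, a_n)` to `a`. -/
def slotTo (a : ∀ i, A i) (j : Fin n) {x : A j} (g : x ⟶ a j) :
    (Function.update a j x : ∀ i, A i) ⟶ a :=
  updateHom (fun i => 𝟙 (a i)) j g ≫ updateSelfHom a j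

theorem slotTo_comp {a b : ∀ i, A i} (f : a ⟶ b) (j : Fin n) {x y : A j} (p : x ⟶ a j)
    (q : y ⟶ b j) (g : x ⟶ y) (w : p ≫ f j = g ≫ q) :
    slotTo a j p ≫ f = updateHom f j g ≫ slotTo b j q := by
  have e : (fun i => 𝟙 (a i) ≫ f i) = fun i => f i ≫ 𝟙 (b i) := by funext i; simp
  unfold slotTo
  rw [Category.assoc, ← updateHom_updateSelfHom, ← Category.assoc, ← Category.assoc,
    updateHom_comp, updateHom_comp, w, e]

end Update

section Multilinear

variable {n : ℕ} {A : Fin n → Type u} [∀ i, Category.{v} (A i)] [∀ i, Preadditive (A i)]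
variable {B : Type u'} [Category.{v'} B] [Preadditive B]

/-- A multilinear functor: an `n`-ary functor which is additive in each component. -/
class IsMultilinear (F : (∀ i, A i) ⥤ B) : Prop where
  additive (a : ∀ i, A i) (j : Fin n) : (slot a j ⋙ F).Additive

instance (F : (∀ i, A i) ⥤ B) [IsMultilinear F] (a : ∀ i, A i) (j : Fin n) :
    (slot a j ⋙ F).Additive :=
  IsMultilinear.additive a j

/-- A right exact multilinear functor: a multilinear functor `F` such that, for each component
`j`, all objects in the other components and every morphism `α` in the `j`-th category,
the natural morphism `cok (F (a_1, …, α, …, a_n)) ⟶ F (a_1, …, cok α, …, a_n)`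
is an isomorphism. -/
class IsRightExact [∀ i, HasCokernels (A i)] [HasCokernels B] (F : (∀ i, A i) ⥤ B) : Prop
    extends IsMultilinear F where
  isIso_cokernelComparison (a : ∀ i, A i) (j : Fin n) {x y : A j} (α : x ⟶ y) :
    IsIso (cokernelComparison α (slot a j ⋙ F))

variable (A B)

/-- The category of multilinear functors `∏ A i ⥤ B` and natural transformations. -/
abbrev HomLin : Type _ :=
  ObjectProperty.FullSubcategory (fun F : (∀ i, A i) ⥤ B => IsMultilinear F)

/-- The category of right exact multilinear functors `∏ A i ⥤ B` and natural
transformations. -/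
abbrev HomLinCok [∀ i, HasCokernels (A i)] [HasCokernels B] : Type _ :=
  ObjectProperty.FullSubcategory (fun F : (∀ i, A i) ⥤ B => IsRightExact F)

variable {A B}

instance (F : HomLin A B) : IsMultilinear F.obj := F.property

theorem map_updateHom_add (F : (∀ i, A i) ⥤ B) [IsMultilinear F] (a : ∀ i, A i) (j : Fin n)
    {x y : A j} (g g' : x ⟶ y) :
    F.map (updateHom (fun i => 𝟙 (a i)) j (g + g')) =
      F.map (updateHom (fun i => 𝟙 (a i)) j g) + F.map (updateHom (fun i => 𝟙 (a i)) j g') :=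
  (slot a j ⋙ F).map_add (f := g) (g := g')

theorem map_updateHom_sub (F : (∀ i, A i) ⥤ B) [IsMultilinear F] (a : ∀ i, A i) (j : Fin n)
    {x y : A j} (g g' : x ⟶ y) :
    F.map (updateHom (fun i => 𝟙 (a i)) j (g - g')) =
      F.map (updateHom (fun i => 𝟙 (a i)) j g) - F.map (updateHom (fun i => 𝟙 (a i)) j g') :=
  (slot a j ⋙ F).map_sub (f := g) (g := g')

/-- A multilinear functor is additive in the `j`-th component of a tuple of morphisms. -/
theorem map_update_sub (F : (∀ i, A i) ⥤ B) [IsMultilinear F] {a b : ∀ i, A i} (f : a ⟶ b)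
    (j : Fin n) (g g' : a j ⟶ b j) :
    F.map (X := a) (Y := b) (Function.update f j (g - g')) =
      F.map (X := a) (Y := b) (Function.update f j g) -
        F.map (X := a) (Y := b) (Function.update f j g') := by
  have key (h : a j ⟶ b j) : (Function.update f j h : a ⟶ b) =
      eqToHom (Function.update_eq_self j a).symm ≫ updateHom (fun i => 𝟙 (a i)) j h ≫
        updateHom f j (𝟙 (b j)) ≫ updateSelfHom b j := by
    funext i
    by_cases hi : i = j
    · subst hi
      simp [updateHom_apply_self]
    · simp [updateHom_apply_of_ne _ _ _ hi, hi]
  rw [key g, key g', key (g - g')]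
  simp only [F.map_comp, map_updateHom_sub, Preadditive.sub_comp, Preadditive.comp_sub]

end Multilinear

section Freyd

variable {V : Type u} [Category.{v} V] [Preadditive V]

/-- The arrow `ρ_a : r_a ⟶ a` of `V` which an object of the Freyd category is. -/
def arrow (X : RightFreyd V) : Arrow V := CategoryTheory.Quotient.as X

/-- The object `a` underlying an object `A = (a ⟵ r_a)` of the Freyd category. -/
abbrev gen (X : RightFreyd V) : V := (arrow X).right

/-- The object `r_a` underlying an object `A = (a ⟵ r_a)` of the Freyd category. -/
abbrev rel (X : RightFreyd V) : V := (arrow X).left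

/-- The morphism `ρ_a : r_a ⟶ a` underlying an object `A = (a ⟵ r_a)` of the Freyd category. -/
abbrev rho (X : RightFreyd V) : rel X ⟶ gen X := (arrow X).hom

/-- A chosen representative of a morphism of the Freyd category: a commutative square
consisting of a morphism datum `(rep φ).right` and a morphism witness `(rep φ).left`. -/
def rep {X Y : RightFreyd V} (φ : X ⟶ Y) : arrow X ⟶ arrow Y :=
  (RightFreyd.quotient V).preimage (X := arrow X) (Y := arrow Y) φ

theorem quotient_map_rep {X Y : RightFreyd V} (φ : X ⟶ Y) :
    (RightFreyd.quotient V).map (rep φ) = φ :=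
  (RightFreyd.quotient V).map_preimage (X := arrow X) (Y := arrow Y) φ

/-- The Freyd category of an additive category has cokernels. -/
instance hasCokernels_freyd [HasFiniteBiproducts V] : HasCokernels (RightFreyd V) :=
  haveI : HasBinaryBiproducts V := hasBinaryBiproducts_of_finite_biproducts V
  inferInstance

end Freyd

section Extension

variable {n : ℕ} {A : Fin n → Type u} [∀ i, Category.{v} (A i)] [∀ i, Preadditive (A i)]
variable {B : Type u'} [Category.{v'} B] [Preadditive B] [HasFiniteBiproducts B]

/-- The tuple `(a_1, …, a_n)` underlying a tuple of objects of the Freyd categories. -/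
abbrev gens (X : ∀ i, RightFreyd (A i)) : ∀ i, A i := fun i => gen (X i)

/-- The tuple `(a_1, …, a_{j-1}, r_{a_j}, a_{j+1}, …, a_n)`. -/
abbrev gensRel (X : ∀ i, RightFreyd (A i)) (j : Fin n) : ∀ i, A i :=
  Function.update (gens X) j (rel (X j))

/-- The morphism `(F(id, …, ρ_{a_j}, …, id))_j` from
`⨁_j F(a_1, …, r_{a_j}, …, a_n)` to `F(a_1, …, a_n)`. -/
def presentation (F : (∀ i, A i) ⥤ B) (X : ∀ i, RightFreyd (A i)) :
    (⨁ fun j => F.obj (gensRel X j)) ⟶ F.obj (gens X) :=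
  biproduct.desc fun j => F.map (slotTo (gens X) j (rho (X j)))

/-- A tuple of chosen morphism data of a tuple of morphisms of the Freyd categories. -/
abbrev repGens {X Y : ∀ i, RightFreyd (A i)} (φ : X ⟶ Y) : gens X ⟶ gens Y :=
  fun i => (rep (φ i)).right

/-- The morphism `(α_1, …, ω_j, …, α_n)` for a tuple of morphisms represented by `(α_i, ω_i)`. -/
abbrev repGensRel {X Y : ∀ i, RightFreyd (A i)} (φ : X ⟶ Y) (j : Fin n) :
    gensRel X j ⟶ gensRel Y j :=
  updateHom (repGens φ) j (rep (φ j)).left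

theorem presentation_comm (F : (∀ i, A i) ⥤ B) {X Y : ∀ i, RightFreyd (A i)} (φ : X ⟶ Y) :
    presentation F X ≫ F.map (repGens φ) =
      biproduct.map (fun j => F.map (repGensRel φ j)) ≫ presentation F Y := by
  refine biproduct.hom_ext' _ _ fun j => ?_
  simp only [presentation, biproduct.ι_desc_assoc, biproduct.ι_map_assoc, biproduct.ι_desc,
    ← F.map_comp]
  congr 1
  exact slotTo_comp _ _ _ _ _ (rep (φ j)).w.symm

theorem presentation_natTrans {F G : (∀ i, A i) ⥤ B} (ν : F ⟶ G) (X : ∀ i, RightFreyd (A i)) :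
    presentation F X ≫ ν.app (gens X) =
      biproduct.map (fun j => ν.app (gensRel X j)) ≫ presentation G X := by
  refine biproduct.hom_ext' _ _ fun j => ?_
  simp [presentation]

variable [HasCokernels B]

/-- If two tuples of morphism data are componentwise equal in the Freyd categories, they
induce the same morphism to the cokernel. -/
theorem map_π_eq (F : (∀ i, A i) ⥤ B) [IsMultilinear F] {a : ∀ i, A i}
    {Y : ∀ i, RightFreyd (A i)} (f g : a ⟶ gens Y)
    (h : ∀ i, ∃ l : a i ⟶ rel (Y i), f i - g i = l ≫ rho (Y i)) :
    F.map f ≫ cokernel.π (presentation F Y) = F.map g ≫ cokernel.π (presentation F Y) := by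
  classical
  choose l hl using h
  have step (k : a ⟶ gens Y) (j : Fin n) :
      F.map (X := a) (Y := gens Y) (Function.update k j (f j)) ≫
          cokernel.π (presentation F Y) =
        F.map (X := a) (Y := gens Y) (Function.update k j (g j)) ≫
          cokernel.π (presentation F Y) := by
    rw [← sub_eq_zero, ← Preadditive.sub_comp, ← map_update_sub, hl]
    have e : (Function.update k j (l j ≫ rho (Y j)) : a ⟶ gens Y) =
        eqToHom (Function.update_eq_self j a).symm ≫ updateHom k j (l j) ≫
          slotTo (gens Y) j (rho (Y j)) := by
      funext i
      by_cases hi : i = j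
      · subst hi
        simp [slotTo, updateHom_apply_self]
      · simp [slotTo, updateHom_apply_of_ne _ _ _ hi, hi]
    have z : F.map (slotTo (gens Y) j (rho (Y j))) ≫ cokernel.π (presentation F Y) = 0 := by
      have e : biproduct.ι (fun j => F.obj (gensRel Y j)) j ≫ presentation F Y =
          F.map (slotTo (gens Y) j (rho (Y j))) := biproduct.ι_desc _ _
      rw [← e, Category.assoc, cokernel.condition, comp_zero]
    rw [e, F.map_comp, F.map_comp, Category.assoc, Category.assoc, z, comp_zero, comp_zero]
  have main (s : Finset (Fin n)) :
      F.map (X := a) (Y := gens Y) (s.piecewise f g) ≫ cokernel.π (presentation F Y) =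
        F.map g ≫ cokernel.π (presentation F Y) := by
    induction s using Finset.induction_on with
    | empty => simp
    | insert j s hj ih =>
      rw [Finset.piecewise_insert, step, ← ih]
      congr 2
      rw [Function.update_eq_iff]
      simp [hj]
  simpa using main Finset.univ

theorem rep_id_sub {V : Type u} [Category.{v} V] [Preadditive V] (X : RightFreyd V) :
    ∃ l : gen X ⟶ rel X, (rep (𝟙 X)).right - 𝟙 (gen X) = l ≫ rho X := by
  have h := RightFreyd.homotopyOfEq (rep (𝟙 X)) (𝟙 (arrow X))
    ((quotient_map_rep (𝟙 X)).trans ((RightFreyd.quotient V).map_id (arrow X)).symm)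
  exact ⟨h.hom, h.comm⟩

theorem rep_comp_sub {V : Type u} [Category.{v} V] [Preadditive V] {X Y Z : RightFreyd V}
    (φ : X ⟶ Y) (ψ : Y ⟶ Z) :
    ∃ l : gen X ⟶ rel Z, (rep (φ ≫ ψ)).right - (rep φ).right ≫ (rep ψ).right = l ≫ rho Z := by
  have h := RightFreyd.homotopyOfEq (rep (φ ≫ ψ)) (rep φ ≫ rep ψ) (by
    rw [Functor.map_comp, quotient_map_rep, quotient_map_rep, quotient_map_rep]
    rfl)
  exact ⟨h.hom, h.comm⟩

/-- The extension `F̂` of a multilinear functor `F`: on objects it is the cokernel of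
`⨁_j F(a_1, …, r_{a_j}, …, a_n) ⟶ F(a_1, …, a_n)`, and on a tuple of morphisms
represented by `(α_i, ω_i)` it is induced on cokernels by `F(α_1, …, α_n)`
and by `⨁_j F(α_1, …, ω_j, …, α_n)`. -/
def extend (F : (∀ i, A i) ⥤ B) [IsMultilinear F] : (∀ i, RightFreyd (A i)) ⥤ B where
  obj X := cokernel (presentation F X)
  map {X Y} φ := cokernel.map (presentation F X) (presentation F Y)
    (biproduct.map fun j => F.map (repGensRel φ j)) (F.map (repGens φ)) (presentation_comm F φ)
  map_id X := by
    rw [← cancel_epi (cokernel.π (presentation F X))]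
    simp only [cokernel.π_desc]
    rw [map_π_eq F (repGens (𝟙 X)) (𝟙 (gens X)) fun i => rep_id_sub (X i)]
    simp
  map_comp {X Y Z} φ ψ := by
    rw [← cancel_epi (cokernel.π (presentation F X))]
    simp only [cokernel.π_desc, cokernel.π_desc_assoc, Category.assoc]
    rw [map_π_eq F (repGens (φ ≫ ψ)) (repGens φ ≫ repGens ψ) fun i => rep_comp_sub (φ i) (ψ i)]
    simp

/-- The projection `F(a_1, …, a_n) ⟶ F̂(A_1, …, A_n)`. -/
def extendπ (F : (∀ i, A i) ⥤ B) [IsMultilinear F] (X : ∀ i, RightFreyd (A i)) :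
    F.obj (gens X) ⟶ (extend F).obj X :=
  cokernel.π (presentation F X)

instance (F : (∀ i, A i) ⥤ B) [IsMultilinear F] (X : ∀ i, RightFreyd (A i)) :
    Epi (extendπ F X) :=
  inferInstanceAs (Epi (cokernel.π (presentation F X)))

theorem extendπ_map (F : (∀ i, A i) ⥤ B) [IsMultilinear F] {X Y : ∀ i, RightFreyd (A i)}
    (φ : X ⟶ Y) : extendπ F X ≫ (extend F).map φ = F.map (repGens φ) ≫ extendπ F Y :=
  cokernel.π_desc _ _ _

/-- The component at `(A_1, …, A_n)` of the extension of a natural transformation. -/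
def extendMapApp {F G : (∀ i, A i) ⥤ B} [IsMultilinear F] [IsMultilinear G] (ν : F ⟶ G)
    (X : ∀ i, RightFreyd (A i)) : (extend F).obj X ⟶ (extend G).obj X :=
  cokernel.map (presentation F X) (presentation G X)
    (biproduct.map fun j => ν.app (gensRel X j)) (ν.app (gens X)) (presentation_natTrans ν X)

theorem extendπ_extendMapApp {F G : (∀ i, A i) ⥤ B} [IsMultilinear F] [IsMultilinear G]
    (ν : F ⟶ G) (X : ∀ i, RightFreyd (A i)) :
    extendπ F X ≫ extendMapApp ν X = ν.app (gens X) ≫ extendπ G X :=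
  cokernel.π_desc _ _ _

/-- The extension `ν̂ : F̂ ⟶ Ĝ` of a natural transformation `ν : F ⟶ G`, induced on cokernels
by the components of `ν`. -/
@[simps]
def extendMap {F G : (∀ i, A i) ⥤ B} [IsMultilinear F] [IsMultilinear G] (ν : F ⟶ G) :
    extend F ⟶ extend G where
  app X := extendMapApp ν X
  naturality {X Y} φ := by
    rw [← cancel_epi (extendπ F X), ← Category.assoc, ← Category.assoc, extendπ_map,
      extendπ_extendMapApp, Category.assoc, Category.assoc, extendπ_extendMapApp, extendπ_map,
      ← Category.assoc, ← Category.assoc, ν.naturality]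

variable (A B)

/-- The functor `F ↦ F̂` from multilinear functors `∏ A i ⥤ B` to functors
`∏ 𝒜(A i) ⥤ B`. -/
def extension : HomLin A B ⥤ ((∀ i, RightFreyd (A i)) ⥤ B) where
  obj F := extend F.obj
  map ν := extendMap ν.hom
  map_id F := by
    ext X
    rw [← cancel_epi (extendπ F.obj X), extendMap_app, extendπ_extendMapApp]
    simp
  map_comp {F G H} ν μ := by
    ext X
    rw [← cancel_epi (extendπ F.obj X), NatTrans.comp_app, extendMap_app, extendMap_app,
      extendMap_app, extendπ_extendMapApp, ← Category.assoc, extendπ_extendMapApp,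
      Category.assoc, extendπ_extendMapApp]
    simp

end Extension

section Restriction

variable {n : ℕ} (A : Fin n → Type u) [∀ i, Category.{v} (A i)] [∀ i, Preadditive (A i)]
  [∀ i, HasFiniteBiproducts (A i)]
variable (B : Type u') [Category.{v'} B] [Preadditive B]

/-- The componentwise embedding `∏ A i ⥤ ∏ 𝒜(A i)`, `(a_i)_i ↦ (a_i ⟵ 0)_i`. -/
def emb : (∀ i, A i) ⥤ (∀ i, RightFreyd (A i)) :=
  Functor.pi fun i => RightFreyd.functor (A i)

variable {A B}

theorem emb_update (a : ∀ i, A i) (j : Fin n) (x : A j) :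
    (emb A).obj (Function.update a j x) =
      Function.update ((emb A).obj a) j ((RightFreyd.functor (A j)).obj x) := by
  funext i
  by_cases h : i = j
  · subst h; simp [emb]
  · simp [emb, h]

theorem emb_map_updateHom (a : ∀ i, A i) (j : Fin n) {x y : A j} (g : x ⟶ y) :
    (emb A).map (updateHom (fun i => 𝟙 (a i)) j g) =
      eqToHom (emb_update a j x) ≫
        updateHom (fun i => 𝟙 ((emb A).obj a i)) j ((RightFreyd.functor (A j)).map g) ≫
          eqToHom (emb_update a j y).symm := by
  funext i
  change (RightFreyd.functor (A i)).map (updateHom (fun i => 𝟙 (a i)) j g i) = _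
  rw [Pi.comp_apply, Pi.comp_apply, Functor.eqToHom_proj, Functor.eqToHom_proj]
  by_cases h : i = j
  · subst h
    rw [updateHom_apply_self, updateHom_apply_self]
    simp only [Functor.map_comp, eqToHom_map, Category.assoc, eqToHom_trans,
      eqToHom_trans_assoc]
    rfl
  · rw [updateHom_apply_of_ne _ _ _ h, updateHom_apply_of_ne _ _ _ h]
    simp only [eqToHom_map, eqToHom_trans, Category.id_comp]
    rfl

/-- The restriction of a multilinear functor along the embedding is multilinear. -/
theorem isMultilinear_restrict (G : (∀ i, RightFreyd (A i)) ⥤ B) [IsMultilinear G] :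
    IsMultilinear (emb A ⋙ G) where
  additive a j :=
    { map_add := fun {x y f g} => by
        change G.map ((emb A).map (updateHom (fun i => 𝟙 (a i)) j (f + g))) =
          G.map ((emb A).map (updateHom (fun i => 𝟙 (a i)) j f)) +
            G.map ((emb A).map (updateHom (fun i => 𝟙 (a i)) j g))
        rw [emb_map_updateHom, emb_map_updateHom, emb_map_updateHom, Functor.map_add]
        simp only [G.map_comp, map_updateHom_add, Preadditive.comp_add, Preadditive.add_comp] }

variable (A B)

/-- The functor `G ↦ G ∘ emb` from right exact multilinear functors `∏ 𝒜(A i) ⥤ B` to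
multilinear functors `∏ A i ⥤ B`. -/
def restriction [HasCokernels B] :
    HomLinCok (fun i => RightFreyd (A i)) B ⥤ HomLin A B :=
  ObjectProperty.lift _
    (ObjectProperty.ι _ ⋙ (Functor.whiskeringLeft _ _ B).obj (emb A))
    fun G => haveI : IsMultilinear G.obj := G.property.toIsMultilinear
      isMultilinear_restrict G.obj

end Restriction

end

end FreydMult

/-!
The extension `F̂` of a multilinear functor `F` and the restriction `G ↦ G ∘ emb` are inverse to
each other because every object `A = (a ⟵ r_a)` of a Freyd category is the cokernel of
`emb ρ_a : emb r_a ⟶ emb a` (`isCok_genProj`).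

*Restricting the extension.* The relations of `emb a` are zero, and a multilinear functor vanishes
on a tuple with a zero component, so the presentation whose cokernel is `F̂(emb a_1, …, emb a_n)` is
the zero morphism to `F(a_1, …, a_n)` (`isIso_extendEmbπ`).

*Extending the restriction.* A right exact multilinear functor preserves cokernels not only
in each component but jointly: if each `ψ_i` is a cokernel of `α_i`, then `G(ψ_1, …, ψ_n)` is the
cokernel of the family `G(id, …, α_j, …, id)` (`epi_map_of_isCok`, `exists_desc_of_isCok`).
This is proved by changing one component of the tuple at a time. Applied to the tuple of
projections `emb a_i ⟶ A_i`, it says that `G(A_1, …, A_n)` is the cokernel which defines the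
extension of `G ∘ emb` (`isIso_counitApp`).

*Right exactness of the extension.* A cokernel in the Freyd category of `α : X ⟶ Y` has, up to
isomorphism, the generators of `Y`, and as relations those of `Y` together with the generators
of `X`. Hence a cokernel `q` is invertible on generators, modulo relations and the image of `α`
(`exists_right_inverse_of_isCok`). A morphism out of `F̂(X_1, …, X_n)` is a morphism out of `F` of
the generators which kills the relations, and multilinearity reduces being killed by the relations
of the cokernel to being killed by the relations of `Y` and by `α` separately
(`map_comp_extendπ_comp_eq_zero`). This gives the universal property of the image under `F̂` of a
tuple of cokernels (`epi_extend_map`, `exists_extend_map_desc`), in particular of a cokernel in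
a single component.
-/

namespace FreydMult

noncomputable section

/-! ### Cokernels as a property of a pair of morphisms -/

section IsCok

variable {C : Type u} [Category.{v} C] [HasZeroMorphisms C]

/-- The morphism `q` is a cokernel of `α`, as a mere proposition (not a chosen colimit cofork). -/
structure IsCok {x y z : C} (α : x ⟶ y) (q : y ⟶ z) : Prop where
  w : α ≫ q = 0
  epi : Epi q
  exists_desc {t : C} (h : y ⟶ t) (hh : α ≫ h = 0) : ∃ h' : z ⟶ t, q ≫ h' = h

namespace IsCok

theorem cokernel_π {x y : C} (α : x ⟶ y) [HasCokernel α] : IsCok α (cokernel.π α) where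
  w := cokernel.condition α
  epi := inferInstance
  exists_desc h hh := ⟨cokernel.desc α h hh, cokernel.π_desc α h hh⟩

theorem of_isIso {x y z : C} (q : y ⟶ z) [IsIso q] : IsCok (0 : x ⟶ y) q where
  w := zero_comp
  epi := inferInstance
  exists_desc h _ := ⟨inv q ≫ h, by simp⟩

theorem of_iso {x y z y' z' : C} {α : x ⟶ y} {q : y ⟶ z} (h : IsCok α q) (b : y ⟶ y') [IsIso b]
    (c : z ⟶ z') [IsIso c] {q' : y' ⟶ z'} (w : b ≫ q' = q ≫ c) : IsCok (α ≫ b) q' where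
  w := by rw [Category.assoc, w, ← Category.assoc, h.w, zero_comp]
  epi := by
    have := h.epi
    rw [show q' = inv b ≫ q ≫ c by rw [← w, IsIso.inv_hom_id_assoc]]
    infer_instance
  exists_desc k hk := by
    obtain ⟨k', hk'⟩ := h.exists_desc (b ≫ k) (by rw [← Category.assoc, hk])
    refine ⟨inv c ≫ k', ?_⟩
    rw [← cancel_epi b, ← Category.assoc, w, Category.assoc, IsIso.hom_inv_id_assoc, hk']

theorem iso_comp {x' x y z : C} {α : x ⟶ y} {q : y ⟶ z} (h : IsCok α q) (a : x' ⟶ x) [IsIso a] :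
    IsCok (a ≫ α) q where
  w := by rw [Category.assoc, h.w, comp_zero]
  epi := h.epi
  exists_desc k hk := h.exists_desc k (by rwa [Category.assoc, ← cancel_epi a, comp_zero] at *)

theorem exists_isIso {x y z z' : C} {α : x ⟶ y} {q : y ⟶ z} {q' : y ⟶ z'} (h : IsCok α q)
    (h' : IsCok α q') : ∃ e : z ⟶ z', IsIso e ∧ q ≫ e = q' := by
  obtain ⟨e, he⟩ := h.exists_desc q' h'.w
  obtain ⟨e', he'⟩ := h'.exists_desc q h.w
  have := h.epi
  have := h'.epi
  refine ⟨e, ⟨e', ?_, ?_⟩, he⟩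
  · rw [← cancel_epi q, ← Category.assoc, he, he', Category.comp_id]
  · rw [← cancel_epi q', ← Category.assoc, he', he, Category.comp_id]

variable {D : Type u'} [Category.{v'} D] [HasZeroMorphisms D]

theorem map_of_isIso_cokernelComparison (G : C ⥤ D) [G.PreservesZeroMorphisms] {x y z : C}
    {α : x ⟶ y} {q : y ⟶ z} [HasCokernel α] [HasCokernel (G.map α)]
    [IsIso (cokernelComparison α G)] (h : IsCok α q) : IsCok (G.map α) (G.map q) := by
  obtain ⟨e, he, rfl⟩ := (cokernel_π α).exists_isIso h
  have := (cokernel_π (G.map α)).of_iso (𝟙 _) (cokernelComparison α G ≫ G.map e)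
    (q' := G.map (cokernel.π α ≫ e)) (by simp)
  simpa using this

theorem isIso_cokernelComparison (G : C ⥤ D) [G.PreservesZeroMorphisms] {x y z : C}
    {α : x ⟶ y} {q : y ⟶ z} [HasCokernel α] [HasCokernel (G.map α)]
    (h : IsCok α q) (h' : IsCok (G.map α) (G.map q)) : IsIso (cokernelComparison α G) := by
  obtain ⟨e, he, rfl⟩ := (cokernel_π α).exists_isIso h
  obtain ⟨e', he', w⟩ := (cokernel_π (G.map α)).exists_isIso h'
  have : cokernelComparison α G = e' ≫ inv (G.map e) := by
    rw [← cancel_epi (cokernel.π (G.map α)), reassoc_of% w]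
    simp
  rw [this]
  infer_instance

end IsCok

end IsCok

/-! ### Tuples of morphisms with a distinguished component -/

section Tuples

theorem isIso_of_forall {ι : Type*} {A : ι → Type u} [∀ i, Category.{v} (A i)] {a b : ∀ i, A i}
    (f : a ⟶ b) (h : ∀ i, IsIso (f i)) : IsIso f :=
  ⟨fun i => inv (f i), by funext i; simp, by funext i; simp⟩

variable {n : ℕ} {A : Fin n → Type u} [∀ i, Category.{v} (A i)]

theorem slotTo_apply_self {a : ∀ i, A i} (j : Fin n) {x : A j} (α : x ⟶ a j) :
    slotTo a j α j = eqToHom (Function.update_self j x a) ≫ α := by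
  simp [slotTo, updateHom_apply_self]

theorem slotTo_apply_of_ne {a : ∀ i, A i} (j : Fin n) {x : A j} (α : x ⟶ a j) {i : Fin n}
    (h : i ≠ j) : slotTo a j α i = eqToHom (Function.update_of_ne h x a) := by
  simp [slotTo, updateHom_apply_of_ne _ _ _ h]

/-- A tuple whose `j`-th component factors through `α` factors through the tuple
`(id, …, α, …, id)`. -/
theorem eq_comp_slotTo {a b : ∀ i, A i} (φ : a ⟶ b) (j : Fin n) {x : A j} (α : x ⟶ b j)
    (l : a j ⟶ x) (h : φ j = l ≫ α) :
    φ = eqToHom (Function.update_eq_self j a).symm ≫ updateHom φ j l ≫ slotTo b j α := by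
  funext i
  by_cases hi : i = j
  · subst hi
    simp [slotTo, updateHom_apply_self, h]
  · simp [slotTo, updateHom_apply_of_ne _ _ _ hi]

/-- The factorisation `ψ = (ψ_1, …, id, …, ψ_n) ≫ (id, …, ψ_j, …, id)` of a tuple. -/
theorem updateHom_id_comp_slotTo {a b : ∀ i, A i} (ψ : a ⟶ b) (j : Fin n) :
    (eqToHom (Function.update_eq_self j a).symm ≫ updateHom ψ j (𝟙 (a j))) ≫
      slotTo b j (ψ j) = ψ := by
  rw [Category.assoc, slotTo, ← Category.assoc (updateHom ψ j _), updateHom_comp]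
  simp only [Category.id_comp, Category.comp_id]
  rw [updateHom_updateSelfHom]
  simp

theorem map_comp_eq_zero_of_slotTo {B : Type u'} [Category.{v'} B]
    [HasZeroMorphisms B] (F : (∀ i, A i) ⥤ B) {a b : ∀ i, A i} (j : Fin n)
    {x : A j} (α : x ⟶ b j) {W : B} (k : F.obj b ⟶ W) (hk : F.map (slotTo b j α) ≫ k = 0)
    (φ : a ⟶ b) (l : a j ⟶ x) (h : φ j = l ≫ α) : F.map φ ≫ k = 0 := by
  rw [eq_comp_slotTo φ j α l h]
  simp [hk]

end Tuples

/-! ### Multilinear functors -/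

section Multilinear

variable {n : ℕ} {A : Fin n → Type u} [∀ i, Category.{v} (A i)] [∀ i, Preadditive (A i)]
variable {B : Type u'} [Category.{v'} B] [Preadditive B]

/-- Additivity of a multilinear functor in the `j`-th component, for three tuples which agree in
the other components. -/
theorem map_eq_add (F : (∀ i, A i) ⥤ B) [IsMultilinear F] {a b : ∀ i, A i} {f g h : a ⟶ b}
    (j : Fin n) (hj : h j = f j + g j) (hf : ∀ i, i ≠ j → f i = h i)
    (hg : ∀ i, i ≠ j → g i = h i) : F.map h = F.map f + F.map g := by
  have key := map_update_sub F h j (h j) (g j)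
  have e₁ : Function.update h j (h j - g j) = f := by
    rw [Function.update_eq_iff]
    exact ⟨by rw [hj, add_sub_cancel_right], fun i hi => (hf i hi).symm⟩
  have e₂ : Function.update h j (g j) = g := by
    rw [Function.update_eq_iff]
    exact ⟨rfl, fun i hi => (hg i hi).symm⟩
  rw [e₁, e₂, Function.update_eq_self] at key
  rw [key, sub_add_cancel]

theorem map_eq_zero (F : (∀ i, A i) ⥤ B) [IsMultilinear F] {a b : ∀ i, A i} {f : a ⟶ b}
    (j : Fin n) (hj : f j = 0) : F.map f = 0 := by
  have := map_eq_add F (f := f) (g := f) (h := f) j (by simp [hj]) (fun _ _ => rfl)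
    (fun _ _ => rfl)
  simpa using this

theorem isMultilinear_of_map_add (F : (∀ i, A i) ⥤ B)
    (H : ∀ {a b : ∀ i, A i} (f g h : a ⟶ b) (j : Fin n), h j = f j + g j →
      (∀ i, i ≠ j → f i = h i) → (∀ i, i ≠ j → g i = h i) → F.map h = F.map f + F.map g) :
    IsMultilinear F where
  additive a j :=
    { map_add := fun {x y f g} => by
        refine H _ _ _ j ?_ (fun i hi => ?_) (fun i hi => ?_)
        · simp only [slot_map, updateHom_apply_self, Preadditive.add_comp,
            Preadditive.comp_add]
          rfl
        · simp only [slot_map, updateHom_apply_of_ne _ _ _ hi]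
          rfl
        · simp only [slot_map, updateHom_apply_of_ne _ _ _ hi]
          rfl }

/-- Two tuples `f`, `g` are identified by `F` followed by `k` as soon as `k` kills every tuple one
of whose components is the corresponding component of `f - g`: the components are exchanged one
at a time. -/
theorem map_comp_eq_of_kills (F : (∀ i, A i) ⥤ B) [IsMultilinear F] {a b : ∀ i, A i} {W : B}
    (k : F.obj b ⟶ W) (f g : a ⟶ b)
    (H : ∀ (j : Fin n) (φ : a ⟶ b), φ j = f j - g j → F.map φ ≫ k = 0) :
    F.map f ≫ k = F.map g ≫ k := by
  classical
  have main (s : Finset (Fin n)) :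
      F.map (X := a) (Y := b) (s.piecewise f g) ≫ k = F.map g ≫ k := by
    induction s using Finset.induction_on with
    | empty => simp
    | insert j s hj ih =>
      rw [← ih, ← sub_eq_zero, ← Preadditive.sub_comp, Finset.piecewise_insert]
      have e : s.piecewise f g = Function.update (s.piecewise f g) j (g j) := by
        rw [eq_comm, Function.update_eq_iff]
        simp [hj]
      conv_lhs => enter [1, 2]; rw [e]
      rw [← map_update_sub]
      exact H j _ (by simp)
  simpa using main Finset.univ

/-! ### Right exact functors and tuples of cokernels -/

section RightExact

variable [∀ i, HasCokernels (A i)] [HasCokernels B] (G : (∀ i, A i) ⥤ B) [IsRightExact G]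

/-- A right exact multilinear functor maps a tuple which is a cokernel of `α` in the `j`-th
component, and an isomorphism in the other ones, to a cokernel of `G(id, …, α, …, id)`. -/
theorem isCok_map_of_slot {a b : ∀ i, A i} (ψ : a ⟶ b) (j : Fin n) {x : A j} (α : x ⟶ a j)
    (hj : IsCok α (ψ j)) (h : ∀ i, i ≠ j → IsIso (ψ i)) :
    IsCok (G.map (slotTo a j α)) (G.map ψ) := by
  have := IsRightExact.isIso_cokernelComparison (F := G) a j α
  have key : IsCok (G.map (updateHom (fun i => 𝟙 (a i)) j α))
      (G.map (updateHom (fun i => 𝟙 (a i)) j (ψ j))) :=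
    IsCok.map_of_isIso_cokernelComparison (slot a j ⋙ G) hj
  have : IsIso (updateHom ψ j (𝟙 (b j)) ≫ updateSelfHom b j) := by
    refine isIso_of_forall _ fun i => ?_
    by_cases hi : i = j
    · subst hi
      simp only [Pi.comp_apply, updateHom_apply_self, Functor.eqToHom_proj]
      infer_instance
    · have := h i hi
      simp only [Pi.comp_apply, updateHom_apply_of_ne _ _ _ hi, Functor.eqToHom_proj]
      infer_instance
  have := key.of_iso (G.map (updateSelfHom a j))
    (G.map (updateHom ψ j (𝟙 (b j)) ≫ updateSelfHom b j)) (q' := G.map ψ) (by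
      rw [← G.map_comp, ← G.map_comp, ← Category.assoc, updateHom_comp]
      simp only [Category.id_comp, Category.comp_id]
      rw [updateHom_updateSelfHom])
  rw [slotTo, G.map_comp]
  exact this

/-- A right exact multilinear functor maps a tuple of cokernels to an epimorphism. The set `s`
contains the components which are not yet known to be isomorphisms. -/
theorem epi_map_of_isCok_aux (s : Finset (Fin n)) {a b : ∀ i, A i} (ψ : a ⟶ b)
    (h : ∀ i ∈ s, ∃ (x : A i) (α : x ⟶ a i), IsCok α (ψ i)) (h' : ∀ i, i ∉ s → IsIso (ψ i)) :
    Epi (G.map ψ) := by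
  induction s using Finset.induction_on generalizing a b with
  | empty =>
    have := isIso_of_forall ψ fun i => h' i (by simp)
    infer_instance
  | insert j s hj ih =>
    rw [← updateHom_id_comp_slotTo ψ j, G.map_comp]
    have e₁ : Epi (G.map (eqToHom (Function.update_eq_self j a).symm ≫
        updateHom ψ j (𝟙 (a j)))) := by
      rw [G.map_comp]
      have : Epi (G.map (updateHom ψ j (𝟙 (a j)))) := by
        refine ih _ (fun i hi => ?_) (fun i hi => ?_)
        · have hij : i ≠ j := fun e => hj (e ▸ hi)
          obtain ⟨x, α, hα⟩ := h i (by simp [hi])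
          refine ⟨x, α ≫ eqToHom (Function.update_of_ne hij _ _).symm, hα.of_iso _
            (eqToHom (Function.update_of_ne hij _ _).symm) ?_⟩
          simp [updateHom_apply_of_ne _ _ _ hij]
        · by_cases hij : i = j
          · subst hij
            rw [updateHom_apply_self]
            infer_instance
          · have := h' i (by simp [hi, hij])
            rw [updateHom_apply_of_ne _ _ _ hij]
            infer_instance
      infer_instance
    have e₂ : Epi (G.map (slotTo b j (ψ j))) := by
      obtain ⟨x, α, hα⟩ := h j (by simp)
      refine (isCok_map_of_slot G _ j (α ≫ eqToHom (Function.update_self j _ _).symm)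
        (hα.of_iso _ (𝟙 _) ?_) fun i hi => ?_).epi
      · simp [slotTo_apply_self]
      · rw [slotTo_apply_of_ne _ _ hi]
        infer_instance
    infer_instance

theorem epi_map_of_isCok {a b : ∀ i, A i} (ψ : a ⟶ b)
    (h : ∀ i, ∃ (x : A i) (α : x ⟶ a i), IsCok α (ψ i)) : Epi (G.map ψ) :=
  epi_map_of_isCok_aux G Finset.univ ψ (fun i _ => h i) fun i hi => absurd (Finset.mem_univ i) hi

/-- The existence part of the joint universal property of a tuple of cokernels. The set `s` contains
the components which are not yet known to be isomorphisms. -/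
theorem exists_desc_of_isCok_aux (s : Finset (Fin n)) {a b : ∀ i, A i} (ψ : a ⟶ b)
    {x : ∀ i, A i} (α : x ⟶ a) (h : ∀ i ∈ s, IsCok (α i) (ψ i)) (h' : ∀ i, i ∉ s → IsIso (ψ i))
    {W : B} (k : G.obj a ⟶ W) (hk : ∀ j ∈ s, G.map (slotTo a j (α j)) ≫ k = 0) :
    ∃ k' : G.obj b ⟶ W, G.map ψ ≫ k' = k := by
  induction s using Finset.induction_on generalizing a b with
  | empty =>
    have := isIso_of_forall ψ fun i => h' i (by simp)
    exact ⟨inv (G.map ψ) ≫ k, by simp⟩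
  | insert j s hj ih =>
    -- `ψ = ψ₁ ≫ slotTo b j (ψ j)`, where `ψ₁` has the identity as its `j`-th component.
    obtain ⟨ψ₁, hψ₁⟩ : ∃ ψ₁, ψ₁ = eqToHom (Function.update_eq_self j a).symm ≫
      updateHom ψ j (𝟙 (a j)) := ⟨_, rfl⟩
    have hfac : ψ₁ ≫ slotTo b j (ψ j) = ψ := by rw [hψ₁, updateHom_id_comp_slotTo]
    have hψ₁j : ψ₁ j = eqToHom (Function.update_self j _ _).symm := by
      simp [hψ₁, updateHom_apply_self]
    have hψ₁i (i : Fin n) (hi : i ≠ j) :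
        ψ₁ i = ψ i ≫ eqToHom (Function.update_of_ne hi _ _).symm := by
      simp [hψ₁, updateHom_apply_of_ne _ _ _ hi]
    have hcok (i : Fin n) (hi : i ∈ s) : IsCok (α i) (ψ₁ i) := by
      have hij : i ≠ j := fun e => hj (e ▸ hi)
      rw [hψ₁i i hij]
      have := (h i (by simp [hi])).of_iso (𝟙 _)
        (eqToHom (Function.update_of_ne hij (a j) b).symm) (Category.id_comp _)
      simpa using this
    have hiso (i : Fin n) (hi : i ∉ s) : IsIso (ψ₁ i) := by
      by_cases hij : i = j
      · subst hij
        rw [hψ₁j]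
        infer_instance
      · have := h' i (by simp [hi, hij])
        rw [hψ₁i i hij]
        infer_instance
    obtain ⟨k₁, hk₁⟩ := ih ψ₁ α hcok hiso k fun i hi => hk i (by simp [hi])
    -- It remains to factor `k₁` through the single slot `j`. That `k₁` is killed by `α j` in this
    -- slot may be checked after composition with the epimorphism `G.map θ`, and there it is the
    -- hypothesis on `k`.
    obtain ⟨θ, hθ⟩ : ∃ θ, θ = updateHom ψ₁ j (𝟙 (x j)) := ⟨_, rfl⟩
    have hθepi : Epi (G.map θ) := by
      refine epi_map_of_isCok G _ fun i => ?_
      by_cases hij : i = j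
      · subst hij
        rw [hθ, updateHom_apply_self]
        exact ⟨x i, 0, IsCok.of_isIso _⟩
      · rw [hθ, updateHom_apply_of_ne _ _ _ hij]
        by_cases hi : i ∈ s
        · exact ⟨_, _, (hcok i hi).of_iso (eqToHom (Function.update_of_ne hij _ _).symm)
            (eqToHom (Function.update_of_ne hij _ _).symm) (by simp)⟩
        · have := hiso i hi
          exact ⟨x i, 0, IsCok.of_isIso _⟩
    have hslot : IsCok (α j ≫ ψ₁ j) (slotTo b j (ψ j) j) := by
      have := hiso j hj
      refine (h j (by simp)).of_iso _ (𝟙 _) ?_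
      rw [hψ₁j, slotTo_apply_self]
      simp
    obtain ⟨k₂, hk₂⟩ := (isCok_map_of_slot G (slotTo b j (ψ j)) j (α j ≫ ψ₁ j) hslot
      fun i hi => by rw [slotTo_apply_of_ne _ _ hi]; infer_instance).exists_desc k₁ (by
        rw [← cancel_epi (G.map θ), comp_zero, ← Category.assoc, ← G.map_comp, hθ,
          ← slotTo_comp ψ₁ j (α j) (α j ≫ ψ₁ j) (𝟙 (x j)) (by simp), G.map_comp, Category.assoc,
          hk₁, hk j (by simp)])
    exact ⟨k₂, by rw [← hfac, G.map_comp, Category.assoc, hk₂, hk₁]⟩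

/-- If each `ψ i` is a cokernel of `α i`, then `G.map ψ` is jointly a cokernel of the morphisms
`G(id, …, α_j, …, id)`; uniqueness of the factorisation is `epi_map_of_isCok`. -/
theorem exists_desc_of_isCok {a b : ∀ i, A i} (ψ : a ⟶ b)
    {x : ∀ i, A i} (α : x ⟶ a) (h : ∀ i, IsCok (α i) (ψ i))
    {W : B} (k : G.obj a ⟶ W) (hk : ∀ j, G.map (slotTo a j (α j)) ≫ k = 0) :
    ∃ k' : G.obj b ⟶ W, G.map ψ ≫ k' = k :=
  exists_desc_of_isCok_aux G Finset.univ ψ α (fun i _ => h i)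
    (fun i hi => absurd (Finset.mem_univ i) hi) k fun j _ => hk j

end RightExact

end Multilinear

/-! ### Morphisms and cokernels in the Freyd category -/

section Freyd

variable {V : Type u} [Category.{v} V] [Preadditive V]

/-- Two morphisms to the generators of `X` agree modulo the relations of `X`. -/
def EqModRel {a : V} {X : RightFreyd V} (f g : a ⟶ gen X) : Prop :=
  ∃ l : a ⟶ rel X, f - g = l ≫ rho X

theorem EqModRel.trans {a : V} {X : RightFreyd V} {f g h : a ⟶ gen X} (h₁ : EqModRel f g)
    (h₂ : EqModRel g h) : EqModRel f h := by
  obtain ⟨l, hl⟩ := h₁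
  obtain ⟨m, hm⟩ := h₂
  exact ⟨l + m, by rw [Preadditive.add_comp, ← hl, ← hm, sub_add_sub_cancel]⟩

theorem EqModRel.comp {a b : V} {X : RightFreyd V} {f g : b ⟶ gen X} (h : EqModRel f g)
    (k : a ⟶ b) : EqModRel (k ≫ f) (k ≫ g) := by
  obtain ⟨l, hl⟩ := h
  exact ⟨k ≫ l, by rw [Category.assoc, ← hl, Preadditive.comp_sub]⟩

theorem EqModRel.refl {a : V} {X : RightFreyd V} (f : a ⟶ gen X) : EqModRel f f :=
  ⟨0, by simp⟩

/-- The morphism of the Freyd category represented by a commutative square. -/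
def homOf {X Y : RightFreyd V} (s : arrow X ⟶ arrow Y) : X ⟶ Y :=
  (RightFreyd.quotient V).map s

theorem homOf_rep {X Y : RightFreyd V} (φ : X ⟶ Y) : homOf (rep φ) = φ :=
  quotient_map_rep φ

theorem homOf_comp {X Y Z : RightFreyd V} (s : arrow X ⟶ arrow Y) (t : arrow Y ⟶ arrow Z) :
    homOf (s ≫ t) = homOf s ≫ homOf t :=
  (RightFreyd.quotient V).map_comp s t

theorem homOf_id (X : RightFreyd V) : homOf (𝟙 (arrow X)) = 𝟙 X :=
  (RightFreyd.quotient V).map_id (arrow X)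

theorem homOf_add {X Y : RightFreyd V} (s t : arrow X ⟶ arrow Y) :
    homOf (s + t) = homOf s + homOf t :=
  (RightFreyd.quotient V).map_add

theorem homOf_zero (X Y : RightFreyd V) : homOf (0 : arrow X ⟶ arrow Y) = 0 :=
  (RightFreyd.quotient V).map_zero _ _

theorem homOf_eq_iff {X Y : RightFreyd V} (s t : arrow X ⟶ arrow Y) :
    homOf s = homOf t ↔ EqModRel s.right t.right := by
  refine (RightFreyd.quotient_map_eq_iff s t).trans ⟨?_, ?_⟩
  · rintro ⟨h⟩
    exact ⟨h.hom, h.comm⟩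
  · rintro ⟨l, hl⟩
    exact ⟨⟨l, hl⟩⟩

theorem eqModRel_rep {X Y : RightFreyd V} {φ : X ⟶ Y} {s : arrow X ⟶ arrow Y}
    (h : homOf s = φ) : EqModRel (rep φ).right s.right := by
  rw [← homOf_eq_iff, homOf_rep, h]

theorem epi_homOf {X Y : RightFreyd V} (s : arrow X ⟶ arrow Y) [IsIso s.right] :
    Epi (homOf s) :=
  RightFreyd.epi_of_isIso_right s

theorem exists_right_eq {X Y : RightFreyd V} {f : gen X ⟶ gen Y} {l : rel X ⟶ rel Y}
    (w : rho X ≫ f = l ≫ rho Y) : ∃ s : arrow X ⟶ arrow Y, s.right = f :=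
  ⟨Arrow.homMk l f w.symm, rfl⟩

/-- The standard cokernel in the Freyd category of a morphism `α : X ⟶ Y`: it has the generators
of `Y`, and the relations `r_y ⊕ x`. -/
def cok [HasBinaryBiproducts V] {X Y : RightFreyd V} (α : X ⟶ Y) : RightFreyd V :=
  (RightFreyd.quotient V).obj (Arrow.mk (biprod.desc (rho Y) (rep α).right))

/-- The commutative square which represents the projection to the standard cokernel; its
component on generators is the identity. -/
def cokπ [HasBinaryBiproducts V] {X Y : RightFreyd V} (α : X ⟶ Y) : arrow Y ⟶ arrow (cok α) :=
  RightFreyd.Candidate.π (rep α)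

theorem isCok_homOf_cokπ [HasBinaryBiproducts V] {X Y : RightFreyd V} (α : X ⟶ Y) :
    IsCok α (homOf (cokπ α)) where
  w := by
    conv_lhs => enter [1]; rw [← homOf_rep α]
    exact (RightFreyd.Candidate.cokernelCofork (rep α)).condition
  epi := inferInstanceAs (Epi ((RightFreyd.quotient V).map (RightFreyd.Candidate.π (rep α))))
  exists_desc h hh :=
    ⟨_, (CokernelCofork.IsColimit.desc' (RightFreyd.Candidate.isColimitCokernelCofork (rep α)) h
      (by rw [quotient_map_rep α]; exact hh)).2⟩

/-- In the Freyd category a cokernel `q` of `α` is, on generators, invertible up to the relations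
of its target on one side, and up to the relations of its source and the image of `α` on the other
side. For the standard cokernel, with relations `r_y ⊕ x`, the inverse `s` is the identity. -/
theorem exists_right_inverse_of_isCok [HasBinaryBiproducts V] {X Y Z : RightFreyd V} {α : X ⟶ Y}
    {q : Y ⟶ Z} (h : IsCok α q) :
    ∃ s : gen Z ⟶ gen Y, EqModRel (s ≫ (rep q).right) (𝟙 (gen Z)) ∧
      (∃ l m, (rep q).right ≫ s - 𝟙 _ = l ≫ rho Y + m ≫ (rep α).right) ∧
      (∃ l m, rho Z ≫ s = l ≫ rho Y + m ≫ (rep α).right) := by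
  obtain ⟨e, he, hqe⟩ := h.exists_isIso (isCok_homOf_cokπ α)
  have desc {t : V} (l : t ⟶ rel Y ⊞ gen X) : l ≫ biprod.desc (rho Y) (rep α).right =
      (l ≫ biprod.fst) ≫ rho Y + (l ≫ biprod.snd) ≫ (rep α).right := by
    rw [biprod.desc_eq]; simp
  refine ⟨(rep e).right, ?_, ?_, ?_⟩
  · have h₁ : EqModRel (rep q).right (rep (inv e)).right := by
      have : EqModRel (rep q).right (cokπ α ≫ rep (inv e)).right :=
        eqModRel_rep (by rw [homOf_comp, homOf_rep, ← hqe]; simp)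
      rwa [show (cokπ α ≫ rep (inv e)).right = (rep (inv e)).right from Category.id_comp _] at this
    have h₂ : EqModRel (rep e ≫ rep (inv e)).right (𝟙 (arrow Z) :).right := by
      rw [← homOf_eq_iff, homOf_comp, homOf_rep, homOf_rep, homOf_id, IsIso.hom_inv_id]
    exact (h₁.comp (rep e).right).trans h₂
  · obtain ⟨l, hl⟩ : EqModRel (rep q ≫ rep e).right (cokπ α).right := by
      rw [← homOf_eq_iff, homOf_comp, homOf_rep, homOf_rep, hqe]
    exact ⟨_, _, hl.trans (desc l)⟩
  · exact ⟨_, _, (rep e).w.symm.trans (desc (rep e).left)⟩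

/-! ### Morphisms out of the image of the embedding -/

section OfGen

variable [HasZeroObject V]

/-- The commutative square from `0 ⟶ a` given by a morphism from `a` to the generators of `X`. -/
def ofGenSq {a : V} {X : RightFreyd V} (f : a ⟶ gen X) :
    arrow ((RightFreyd.functor V).obj a) ⟶ arrow X :=
  Arrow.homMk (f := (RightFreyd.rightFunctor V).obj a) 0 f ((isZero_zero V).eq_of_src _ _)

/-- The source `0 ⟶ a` has no relations, so a square from it is determined on generators. -/
theorem emb_sq_ext {a : V} {X : RightFreyd V} {s t : arrow ((RightFreyd.functor V).obj a) ⟶ arrow X}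
    (h : s.right = t.right) : s = t := by
  ext
  · exact (isZero_zero V).eq_of_src _ _
  · exact h

/-- The morphism `emb a ⟶ X` of the Freyd category represented by a morphism from `a` to the
generators of `X`. -/
def ofGen {a : V} {X : RightFreyd V} (f : a ⟶ gen X) : (RightFreyd.functor V).obj a ⟶ X :=
  homOf (ofGenSq f)

theorem eqModRel_rep_ofGen {a : V} {X : RightFreyd V} (f : a ⟶ gen X) :
    EqModRel f (rep (ofGen f)).right :=
  (homOf_eq_iff (ofGenSq f) _).1 (homOf_rep _).symm

theorem ofGen_eq_iff {a : V} {X : RightFreyd V} (f g : a ⟶ gen X) :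
    ofGen f = ofGen g ↔ EqModRel f g :=
  homOf_eq_iff (ofGenSq f) (ofGenSq g)

theorem ofGen_rep_right {a : V} {X : RightFreyd V} (φ : (RightFreyd.functor V).obj a ⟶ X) :
    ofGen (rep φ).right = φ := by
  conv_rhs => rw [← homOf_rep φ]
  exact congrArg homOf (emb_sq_ext rfl)

theorem ofGen_comp {a : V} {X Y : RightFreyd V} (f : a ⟶ gen X) (φ : X ⟶ Y) :
    ofGen f ≫ φ = ofGen (f ≫ (rep φ).right) := by
  conv_lhs => rw [← homOf_rep φ]
  rw [ofGen, ← homOf_comp]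
  exact congrArg homOf (emb_sq_ext rfl)

theorem functor_map_ofGen {a b : V} {X : RightFreyd V} (g : a ⟶ b) (f : b ⟶ gen X) :
    (RightFreyd.functor V).map g ≫ ofGen f = ofGen (g ≫ f) := by
  refine (homOf_comp (X := (RightFreyd.functor V).obj a) (Y := (RightFreyd.functor V).obj b)
    ((RightFreyd.rightFunctor V).map g) (ofGenSq f)).symm.trans ?_
  exact congrArg homOf (emb_sq_ext rfl)

theorem ofGen_zero (a : V) (X : RightFreyd V) : ofGen (0 : a ⟶ gen X) = 0 := by
  rw [← homOf_zero]
  exact congrArg homOf (emb_sq_ext rfl)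

/-- The projection from the generators: the object `A = (a ⟵ r_a)` is the cokernel of
`emb ρ_a : emb r_a ⟶ emb a`. -/
abbrev genProj (X : RightFreyd V) : (RightFreyd.functor V).obj (gen X) ⟶ X := ofGen (𝟙 (gen X))

theorem isCok_genProj (X : RightFreyd V) :
    IsCok ((RightFreyd.functor V).map (rho X)) (genProj X) where
  w := by
    rw [functor_map_ofGen, Category.comp_id, ← ofGen_zero, ofGen_eq_iff]
    exact ⟨𝟙 _, by simp⟩
  epi := by
    have : IsIso (ofGenSq (𝟙 (gen X))).right := inferInstanceAs (IsIso (𝟙 (gen X)))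
    exact epi_homOf _
  exists_desc {Z} h hh := by
    obtain ⟨f, rfl⟩ : ∃ f : gen X ⟶ gen Z, ofGen f = h := ⟨_, ofGen_rep_right h⟩
    rw [functor_map_ofGen, ← ofGen_zero, ofGen_eq_iff] at hh
    obtain ⟨l, hl⟩ := hh
    rw [sub_zero] at hl
    obtain ⟨s, hs⟩ := exists_right_eq hl
    refine ⟨homOf s, ?_⟩
    rw [genProj, ofGen, ← homOf_comp]
    exact congrArg homOf (emb_sq_ext ((Category.id_comp _).trans hs))

end OfGen

end Freyd

/-! ### Right exactness of the extension -/

section ExtendRightExact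

variable {n : ℕ} {A : Fin n → Type u} [∀ i, Category.{v} (A i)] [∀ i, Preadditive (A i)]
variable {B : Type u'} [Category.{v'} B] [Preadditive B] [HasFiniteBiproducts B] [HasCokernels B]
variable (F : (∀ i, A i) ⥤ B) [IsMultilinear F]

theorem map_slotTo_rho_extendπ (X : ∀ i, RightFreyd (A i)) (j : Fin n) :
    F.map (slotTo (gens X) j (rho (X j))) ≫ extendπ F X = 0 := by
  have e : biproduct.ι (fun j => F.obj (gensRel X j)) j ≫ presentation F X =
      F.map (slotTo (gens X) j (rho (X j))) := biproduct.ι_desc _ _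
  have z : F.map (slotTo (gens X) j (rho (X j))) ≫ cokernel.π (presentation F X) = 0 := by
    rw [← e, Category.assoc, cokernel.condition, comp_zero]
  exact z

theorem exists_extendπ_desc (X : ∀ i, RightFreyd (A i)) {W : B} (k : F.obj (gens X) ⟶ W)
    (hk : ∀ j, F.map (slotTo (gens X) j (rho (X j))) ≫ k = 0) :
    ∃ k' : (extend F).obj X ⟶ W, extendπ F X ≫ k' = k :=
  ⟨cokernel.desc (presentation F X) k (biproduct.hom_ext' _ _ fun j => by
    rw [presentation, biproduct.ι_desc_assoc, hk, comp_zero]), cokernel.π_desc _ _ _⟩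

theorem map_comp_extendπ_eq {a : ∀ i, A i} {X : ∀ i, RightFreyd (A i)} (f g : a ⟶ gens X)
    (h : ∀ i, EqModRel (f i) (g i)) : F.map f ≫ extendπ F X = F.map g ≫ extendπ F X :=
  map_π_eq F f g h

instance isMultilinear_extend : IsMultilinear (extend F) := by
  refine isMultilinear_of_map_add _ fun {X Y} f g h j hj hf hg => ?_
  -- A representative of `h` whose `j`-th component is a sum of representatives of `f j`, `g j`.
  have hr : EqModRel (rep (h j)).right ((rep (f j)).right + (rep (g j)).right) :=
    eqModRel_rep (s := rep (f j) + rep (g j)) (by rw [homOf_add, homOf_rep, homOf_rep, hj])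
  have key (k : gen (X j) ⟶ gen (Y j)) (φ : X ⟶ Y) (h₁ : EqModRel (rep (φ j)).right k)
      (h₂ : ∀ i, i ≠ j → φ i = h i) :
      F.map (repGens φ) ≫ extendπ F Y =
        F.map (X := gens X) (Y := gens Y) (Function.update (repGens h) j k) ≫ extendπ F Y := by
    refine map_comp_extendπ_eq F _ _ fun i => ?_
    by_cases hi : i = j
    · subst hi
      rw [Function.update_self]
      exact h₁
    · rw [Function.update_of_ne hi, repGens, h₂ i hi]
      exact EqModRel.refl _
  rw [← cancel_epi (extendπ F X), Preadditive.comp_add, extendπ_map, extendπ_map, extendπ_map,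
    key _ h hr fun _ _ => rfl, key _ f (EqModRel.refl _) hf, key _ g (EqModRel.refl _) hg,
    ← Preadditive.add_comp]
  congr 1
  refine map_eq_add F j (by simp) (fun i hi => ?_) (fun i hi => ?_)
  · rw [Function.update_of_ne hi, Function.update_of_ne hi]
  · rw [Function.update_of_ne hi, Function.update_of_ne hi]

variable [∀ i, HasFiniteBiproducts (A i)]

/-- The tuple of morphisms `emb a_i ⟶ X_i` represented by morphisms from `a_i` to the generators
of `X_i`. -/
def ofGens {a : ∀ i, A i} {X : ∀ i, RightFreyd (A i)} (f : a ⟶ gens X) : (emb A).obj a ⟶ X :=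
  fun i => ofGen (f i)

/-- The projection `F(a_1, …, a_n) ⟶ F̂(emb a_1, …, emb a_n)`. -/
def extendEmbπ (a : ∀ i, A i) : F.obj a ⟶ (extend F).obj ((emb A).obj a) :=
  extendπ F ((emb A).obj a)

theorem extendEmbπ_map_ofGens {a : ∀ i, A i} {X : ∀ i, RightFreyd (A i)} (f : a ⟶ gens X) :
    extendEmbπ F a ≫ (extend F).map (ofGens f) = F.map f ≫ extendπ F X :=
  (extendπ_map F (ofGens f)).trans
    (map_comp_extendπ_eq F f _ fun i => eqModRel_rep_ofGen (f i)).symm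

/-- If `k` is killed by `F̂(id, …, α, …, id)`, then on generators it is killed by every tuple
whose `j`-th component factors through `α` modulo the relations of `X j`. -/
theorem map_comp_extendπ_comp_eq_zero {X : ∀ i, RightFreyd (A i)} (j : Fin n)
    {x : RightFreyd (A j)} (α : x ⟶ X j) {W : B} (k : (extend F).obj X ⟶ W)
    (hk : (extend F).map (slotTo X j α) ≫ k = 0) {a : ∀ i, A i} (φ : a ⟶ gens X)
    (l : a j ⟶ rel (X j)) (m : a j ⟶ gen x)
    (hφ : φ j = l ≫ rho (X j) + m ≫ (rep α).right) :
    F.map φ ≫ extendπ F X ≫ k = 0 := by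
  have h₁ : F.map (X := a) (Y := gens X) (Function.update φ j (l ≫ rho (X j))) ≫
      extendπ F X = 0 :=
    map_comp_eq_zero_of_slotTo F j (rho (X j)) _ (map_slotTo_rho_extendπ F X j) _ l (by simp)
  have h₂ : F.map (X := a) (Y := gens X) (Function.update φ j (m ≫ (rep α).right)) ≫
      extendπ F X ≫ k = 0 := by
    rw [← Category.assoc, ← extendEmbπ_map_ofGens, Category.assoc,
      map_comp_eq_zero_of_slotTo (extend F) j α k hk _ (ofGen m), comp_zero]
    rw [ofGens, Function.update_self]
    exact (ofGen_comp m α).symm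
  rw [map_eq_add F (f := Function.update φ j (l ≫ rho (X j)))
    (g := Function.update φ j (m ≫ (rep α).right)) (h := φ) j (by simpa using hφ)
    (fun i hi => Function.update_of_ne hi _ _) (fun i hi => Function.update_of_ne hi _ _),
    Preadditive.add_comp, h₂, reassoc_of% h₁, zero_comp, add_zero]

/-- The morphism `F̂(ψ)` is an epimorphism because `ψ` has a right inverse on generators, modulo the
relations of `Y`. -/
theorem epi_extend_map {X Y x : ∀ i, RightFreyd (A i)} (α : x ⟶ X) (ψ : X ⟶ Y)
    (h : ∀ i, IsCok (α i) (ψ i)) : Epi ((extend F).map ψ) := by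
  have (i : Fin n) : HasBinaryBiproducts (A i) := hasBinaryBiproducts_of_finite_biproducts _
  choose s hs _ _ using fun i => exists_right_inverse_of_isCok (h i)
  have e : extendπ F Y = F.map (X := gens Y) (Y := gens X) s ≫ extendπ F X ≫
      (extend F).map ψ := by
    rw [extendπ_map, ← Category.assoc, ← F.map_comp,
      map_comp_extendπ_eq F (X := Y) (_ ≫ repGens ψ) (𝟙 (gens Y)) hs, F.map_id, Category.id_comp]
  have : Epi (F.map (X := gens Y) (Y := gens X) s ≫ extendπ F X ≫ (extend F).map ψ) := by
    rw [← e]; infer_instance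
  have := epi_of_epi (F.map (X := gens Y) (Y := gens X) s) (extendπ F X ≫ (extend F).map ψ)
  exact epi_of_epi (extendπ F X) ((extend F).map ψ)

/-- If each `ψ i` is a cokernel of `α i`, then `F̂(ψ)` is jointly a cokernel of the morphisms
`F̂(id, …, α_j, …, id)`; uniqueness of the factorisation is `epi_extend_map`. -/
theorem exists_extend_map_desc {X Y x : ∀ i, RightFreyd (A i)} (α : x ⟶ X) (ψ : X ⟶ Y)
    (h : ∀ i, IsCok (α i) (ψ i)) {W : B} (k : (extend F).obj X ⟶ W)
    (hk : ∀ j, (extend F).map (slotTo X j (α j)) ≫ k = 0) :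
    ∃ k' : (extend F).obj Y ⟶ W, (extend F).map ψ ≫ k' = k := by
  have (i : Fin n) : HasBinaryBiproducts (A i) := hasBinaryBiproducts_of_finite_biproducts _
  choose s _ hs hs' using fun i => exists_right_inverse_of_isCok (h i)
  obtain ⟨k', hk'⟩ := exists_extendπ_desc F Y
    (F.map (X := gens Y) (Y := gens X) s ≫ extendπ F X ≫ k) fun j => by
      obtain ⟨l, m, hlm⟩ := hs' j
      rw [← Category.assoc, ← F.map_comp]
      refine map_comp_extendπ_comp_eq_zero F j (α j) k (hk j) _
        (eqToHom (Function.update_self j _ _) ≫ l) (eqToHom (Function.update_self j _ _) ≫ m) ?_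
      rw [Pi.comp_apply, slotTo_apply_self, Category.assoc, hlm]
      simp
  refine ⟨k', ?_⟩
  rw [← cancel_epi (extendπ F X), ← Category.assoc, extendπ_map, Category.assoc, hk',
    ← Category.assoc, ← F.map_comp]
  refine (map_comp_eq_of_kills F (extendπ F X ≫ k) (repGens ψ ≫ s) (𝟙 (gens X))
    fun j φ hφ => ?_).trans (by simp)
  obtain ⟨l, m, hlm⟩ := hs j
  exact map_comp_extendπ_comp_eq_zero F j (α j) k (hk j) φ l m (hφ.trans hlm)

/-- The universal property for a tuple of cokernels, in the case of a single component: the identity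
is a cokernel of zero in the other components. -/
theorem isCok_extend_map_updateHom (X : ∀ i, RightFreyd (A i)) (j : Fin n)
    {x y z : RightFreyd (A j)} {α : x ⟶ y} {q : y ⟶ z} (h : IsCok α q) :
    IsCok ((extend F).map (updateHom (fun i => 𝟙 (X i)) j α))
      ((extend F).map (updateHom (fun i => 𝟙 (X i)) j q)) := by
  -- The tuple with `j`-th component `α` and zero in the other components.
  obtain ⟨β, hβ, hβ'⟩ : ∃ β : (Function.update X j x : ∀ i, RightFreyd (A i)) ⟶
      (Function.update X j y : ∀ i, RightFreyd (A i)),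
      β j = updateHom (fun i => 𝟙 (X i)) j α j ∧ ∀ i, i ≠ j → β i = 0 :=
    ⟨fun i => if i = j then updateHom (fun i => 𝟙 (X i)) j α i else 0, by simp,
      fun i hi => by simp [hi]⟩
  have hcok (i : Fin n) : IsCok (β i) (updateHom (fun i => 𝟙 (X i)) j q i) := by
    by_cases hi : i = j
    · subst hi
      rw [hβ, updateHom_apply_self, updateHom_apply_self]
      exact (h.of_iso (eqToHom (Function.update_self i y X).symm)
        (eqToHom (Function.update_self i z X).symm) (by simp)).iso_comp _
    · rw [hβ' i hi, updateHom_apply_of_ne _ _ _ hi]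
      exact IsCok.of_isIso _
  refine ⟨?_, epi_extend_map F β _ hcok, fun {W} k hk => ?_⟩
  · rw [← Functor.map_comp]
    exact map_eq_zero _ j (by simp [updateHom_apply_self, reassoc_of% h.w])
  · refine exists_extend_map_desc F β _ hcok k fun i => ?_
    by_cases hi : i = j
    · subst hi
      have e : slotTo _ i (β i) = eqToHom (by simp) ≫ updateHom (fun i => 𝟙 (X i)) i α := by
        funext t
        by_cases ht : t = i
        · subst ht
          simp [slotTo_apply_self, hβ, updateHom_apply_self]
        · simp [slotTo_apply_of_ne _ _ ht, updateHom_apply_of_ne _ _ _ ht]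
      rw [e, Functor.map_comp, Category.assoc, hk, comp_zero]
    · rw [map_eq_zero (extend F) (f := slotTo _ i (β i)) i
        (by rw [slotTo_apply_self, hβ' i hi, comp_zero]), zero_comp]

theorem isRightExact_extend : IsRightExact (extend F) where
  isIso_cokernelComparison X j {_ _} α :=
    IsCok.isIso_cokernelComparison (slot X j ⋙ extend F) (IsCok.cokernel_π α)
      (isCok_extend_map_updateHom F X j (IsCok.cokernel_π α))

end ExtendRightExact

/-! ### The equivalence -/

section Equivalence

variable {n : ℕ} {A : Fin n → Type u} [∀ i, Category.{v} (A i)] [∀ i, Preadditive (A i)]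
  [∀ i, HasFiniteBiproducts (A i)]
variable {B : Type u'} [Category.{v'} B] [Preadditive B]

/-- The tuple of projections `emb a_i ⟶ (a_i ⟵ r_{a_i})`. -/
def genProjs (X : ∀ i, RightFreyd (A i)) : (emb A).obj (gens X) ⟶ X := fun i => genProj (X i)

/-- The image of `g` under the embedding, as a morphism to a component of a tuple in the image of
`emb A`. -/
def embHom {a : ∀ i, A i} {j : Fin n} {x : A j} (g : x ⟶ a j) :
    (RightFreyd.functor (A j)).obj x ⟶ (emb A).obj a j :=
  (RightFreyd.functor (A j)).map g

theorem emb_map_slotTo (a : ∀ i, A i) (j : Fin n) {x : A j} (g : x ⟶ a j) :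
    (emb A).map (slotTo a j g) =
      eqToHom (emb_update a j x) ≫ slotTo ((emb A).obj a) j (embHom g) := by
  rw [slotTo, Functor.map_comp, emb_map_updateHom, eqToHom_map]
  change _ = eqToHom _ ≫ updateHom (fun i => 𝟙 ((emb A).obj a i)) j (embHom g) ≫
    updateSelfHom ((emb A).obj a) j
  simp only [Category.assoc]
  congr 2
  exact eqToHom_trans _ _

theorem isCok_genProjs (X : ∀ i, RightFreyd (A i)) (i : Fin n) :
    IsCok (embHom (a := gens X) (rho (X i))) (genProjs X i) :=
  isCok_genProj (X i)

theorem genProjs_naturality {X Y : ∀ i, RightFreyd (A i)} (φ : X ⟶ Y) :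
    (emb A).map (repGens φ) ≫ genProjs Y = genProjs X ≫ φ := by
  funext i
  change (RightFreyd.functor (A i)).map (rep (φ i)).right ≫ genProj (Y i) = genProj (X i) ≫ φ i
  rw [functor_map_ofGen, ofGen_comp, Category.id_comp, Category.comp_id]

theorem map_slotTo_map_genProjs (G : (∀ i, RightFreyd (A i)) ⥤ B) [IsMultilinear G]
    (X : ∀ i, RightFreyd (A i)) (j : Fin n) :
    (emb A ⋙ G).map (slotTo (gens X) j (rho (X j))) ≫ G.map (genProjs X) = 0 := by
  rw [Functor.comp_map, ← G.map_comp]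
  refine map_eq_zero G j ?_
  rw [emb_map_slotTo, Pi.comp_apply, Pi.comp_apply, slotTo_apply_self, Category.assoc,
    Category.assoc, (isCok_genProjs X j).w, comp_zero, comp_zero]

variable [HasFiniteBiproducts B] [HasCokernels B]

/-- The relations of `emb a` are zero, so `F̂(emb a_1, …, emb a_n)` is `F(a_1, …, a_n)`. -/
instance isIso_extendEmbπ (F : (∀ i, A i) ⥤ B) [IsMultilinear F] (a : ∀ i, A i) :
    IsIso (extendEmbπ F a) := by
  have z : presentation F ((emb A).obj a) = 0 := by
    refine biproduct.hom_ext' _ _ fun j => ?_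
    rw [presentation, biproduct.ι_desc, comp_zero]
    exact map_eq_zero F j (by
      rw [slotTo_apply_self, show rho ((emb A).obj a j) = 0 from rfl, comp_zero])
  have : IsIso (cokernel.π (presentation F ((emb A).obj a))) := by
    rw [z]; infer_instance
  exact this

theorem emb_map_eq_ofGens {a b : ∀ i, A i} (f : a ⟶ b) :
    (emb A).map f = ofGens (X := (emb A).obj b) f := by
  funext i
  exact congrArg homOf (emb_sq_ext rfl)

/-- `F` is naturally isomorphic to the restriction of its extension. -/
def extendEmbIso (F : (∀ i, A i) ⥤ B) [IsMultilinear F] : F ≅ emb A ⋙ extend F :=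
  NatIso.ofComponents (fun a => asIso (extendEmbπ F a)) fun {a b} f => by
    change F.map f ≫ extendπ F ((emb A).obj b) =
      extendEmbπ F a ≫ (extend F).map ((emb A).map f)
    rw [emb_map_eq_ofGens]
    exact (extendEmbπ_map_ofGens F (X := (emb A).obj b) f).symm

variable (G : (∀ i, RightFreyd (A i)) ⥤ B) [IsRightExact G]

instance isMultilinear_emb_comp : IsMultilinear (emb A ⋙ G) :=
  isMultilinear_restrict G

/-- The comparison morphism from the extension of the restriction of `G` to `G`. -/
def counitApp (X : ∀ i, RightFreyd (A i)) : (extend (emb A ⋙ G)).obj X ⟶ G.obj X :=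
  (exists_extendπ_desc (emb A ⋙ G) X (G.map (genProjs X)) (map_slotTo_map_genProjs G X)).choose

theorem extendπ_counitApp (X : ∀ i, RightFreyd (A i)) :
    extendπ (emb A ⋙ G) X ≫ counitApp G X = G.map (genProjs X) :=
  (exists_extendπ_desc (emb A ⋙ G) X (G.map (genProjs X))
    (map_slotTo_map_genProjs G X)).choose_spec

/-- Right exactness of `G` in each component identifies `G(A_1, …, A_n)` with the joint cokernel
of the morphisms `G(emb a_1, …, emb ρ_{a_j}, …, emb a_n)`. -/
instance isIso_counitApp (X : ∀ i, RightFreyd (A i)) : IsIso (counitApp G X) := by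
  have hepi : Epi (G.map (genProjs X)) :=
    epi_map_of_isCok G _ fun i => ⟨_, _, isCok_genProjs X i⟩
  obtain ⟨k, hk⟩ := exists_desc_of_isCok G (genProjs X)
    (x := fun i => (RightFreyd.functor (A i)).obj (rel (X i)))
    (fun i => embHom (a := gens X) (rho (X i))) (isCok_genProjs X)
    (extendπ (emb A ⋙ G) X) fun j => by
      have h := map_slotTo_rho_extendπ (emb A ⋙ G) X j
      rw [Functor.comp_map, emb_map_slotTo, G.map_comp, Category.assoc] at h
      rwa [← cancel_epi (G.map (eqToHom (emb_update (gens X) j (rel (X j))))), comp_zero]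
  refine ⟨k, ?_, ?_⟩
  · rw [← cancel_epi (extendπ (emb A ⋙ G) X), ← Category.assoc, extendπ_counitApp, hk,
      Category.comp_id]
  · rw [← cancel_epi (G.map (genProjs X)), ← Category.assoc, hk, extendπ_counitApp,
      Category.comp_id]

/-- A right exact multilinear functor is naturally isomorphic to the extension of its
restriction. -/
def counitIso : extend (emb A ⋙ G) ≅ G :=
  NatIso.ofComponents (fun X => asIso (counitApp G X)) fun {X Y} φ => by
    rw [asIso_hom, asIso_hom, ← cancel_epi (extendπ (emb A ⋙ G) X), ← Category.assoc,
      extendπ_map, Category.assoc, extendπ_counitApp, ← Category.assoc, extendπ_counitApp,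
      Functor.comp_map, ← G.map_comp, ← G.map_comp, genProjs_naturality]

theorem isRightExact_extension (F : HomLin A B) : IsRightExact ((extension A B).obj F) :=
  isRightExact_extend F.obj

instance (G : HomLinCok (fun i => RightFreyd (A i)) B) : IsRightExact G.obj := G.property

variable (A B)

/-- Extension along the embeddings and restriction are mutually inverse equivalences. -/
def extensionEquivalence : HomLin A B ≌ HomLinCok (fun i => RightFreyd (A i)) B :=
  CategoryTheory.Equivalence.mk (ObjectProperty.lift _ (extension A B) isRightExact_extension)
    (restriction A B)
    (NatIso.ofComponents (fun F => ObjectProperty.isoMk _ (extendEmbIso F.obj)) fun {F G} ν => by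
      ext a
      exact (extendπ_extendMapApp ν.hom ((emb A).obj a)).symm)
    (NatIso.ofComponents (fun G => ObjectProperty.isoMk _ (counitIso G.obj)) fun {G H} ν => by
      ext X
      change extendMapApp (Functor.whiskerLeft (emb A) ν.hom) X ≫ counitApp H.obj X =
        counitApp G.obj X ≫ ν.hom.app X
      rw [← cancel_epi (extendπ (emb A ⋙ G.obj) X), ← Category.assoc, extendπ_extendMapApp,
        Category.assoc, extendπ_counitApp, ← Category.assoc, extendπ_counitApp]
      exact (ν.hom.naturality _).symm)

end Equivalence

end

end FreydMult

theorem mainTheorem1 {n : ℕ} (A : Fin n → Type u) [∀ i, Category.{v} (A i)]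
    [∀ i, Preadditive (A i)] [∀ i, HasFiniteBiproducts (A i)]
    (B : Type u') [Category.{v'} B] [Preadditive B] [HasFiniteBiproducts B] [HasCokernels B] :
    ∃ (h : ∀ F : FreydMult.HomLin A B, FreydMult.IsRightExact ((FreydMult.extension A B).obj F))
      (e : FreydMult.HomLin A B ≌ FreydMult.HomLinCok (fun i => RightFreyd (A i)) B),
      e.functor = ObjectProperty.lift _ (FreydMult.extension A B) h ∧
        e.inverse = FreydMult.restriction A B :=
  ⟨FreydMult.isRightExact_extension, FreydMult.extensionEquivalence A B, rfl, rfl⟩
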